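/- **Theorem 4.1.** Let $A,B$ be real symmetric positive definite $m\times m$ matrices and $0<q<1$. Put $$X=A^{-1/2}BA^{-1/2},\qquad f_s(A|B)=A^{1/2}X^{s}A^{1/2}\ (s\in\mathbb R),\qquad S_q(A|B)=A^{1/2}X^{q}\ln (X)A^{1/2},$$ $$D_q(A|B)=f_{1+q}(A|B)-f_q(A|B)-S_q(A|B)\qquad(\text{where } f_{1+q}(A|B)=f_{-q}(B|A)).$$ For square matrices write $\frac{N}{D}=D^{-1}N$ ($D$ invertible). For matrix sequences $(a_n)_{n\ge0},(b_n)_{n\ge1}$ the numerators and denominators of the continued fraction $\left[a_0;\frac{b_1}{a_1},\frac{b_2}{a_2},\dots\right]$ are given by $\mathcal P_{-1}=I$, $\mathcal P_0=a_0$, $\mathcal Q_{-1}=0$, $\mathcal Q_0=I$, $\mathcal P_n=a_n\mathcal P_{n-1}+b_n\mathcal P_{n-2}$, $\mathcal Q_n=a_n\mathcal Q_{n-1}+b_n\mathcal Q_{n-2}$ $(n\ge1)$. It is *well defined* if all $\mathcal Q_n$ are invertible, and it then has the value $F$ if $\mathcal Q_n^{-1}\mathcal P_n\to F$. Assume that $A-B$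 is invertible. Then $\varphi=(I+X)^{-1}(I-X)$ is invertible. Let $$A'_0=I,\qquad A'_1=\frac{-I-q\varphi}{2q\varphi},\qquad A'_{2k}=\frac{-2q\,(4k-1)\prod_{j=1}^{k-1}\left(q^2-(2j)^2\right)}{\prod_{j=1}^{k}\left(q^2-(2j-1)^2\right)}\,\varphi^{-1}\quad(k\ge1),$$ $$A'_{2k+1}=\frac{-(4k+1)\prod_{j=1}^{k}\left(q^2-(2j-1)^2\right)}{2q\prod_{j=1}^{k}\left(q^2-(2j)^2\right)}\,\varphi^{-1}\quad(k\ge1),$$ $$\widetilde A'_0=X-I,\qquad \widetilde A'_{2k}=\frac{-2(4k-1)\prod_{j=1}^{k-1}(2j)^2}{\prod_{j=1}^{k}(2j-1)^2}\,\varphi^{-1}\quad(k\ge1),\qquad \widetilde A'_{2k+1}=\frac{(4k+1)\prod_{j=1}^{k}(2j-1)^2}{2\prod_{j=1}^{k}(2j)^2}\,\varphi^{-1}\quad(k\ge0).$$ Let $P_n,Q_n$ (resp. $\widetilde P_n,\widetilde Q_n$) be the numerators and denominators of $\left[A'_0;\frac{I}{A'_k}\right]_{k\ge1}$ (resp. $\left[\widetilde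 A'_0;\frac{I}{\widetilde A'_k}\right]_{k\ge1}$), and for $n\ge2$ put $$E_n=Q_n\widetilde Q_n\left(Q_{n-2}P_{n-1}+\widetilde Q_{n-1}\widetilde P_{n-2}\right),\qquad F_n=Q_{n-2}\widetilde Q_{n-2}\left(Q_nP_{n-1}+\widetilde Q_{n-1}\widetilde P_n\right).$$ Then, provided that the continued fraction on the right is well defined, $$D_q(A|B)=\left[B-A;\ \frac{(A'_1+I+\widetilde A'_0\widetilde A'_1)A^{1/2}}{A'_1\widetilde A'_1A^{-1/2}},\ \frac{\left((A'_1A'_2+I)(A'_1+I)+\widetilde A'_1\widetilde A'_2+\widetilde A'_0\widetilde A'_1(\widetilde A'_1\widetilde A'_2+I)\right)A^{-1/2}}{(A'_1A'_2+A'_2+I)\widetilde A'_2+A'_2\widetilde A'_0(\widetilde A'_1\widetilde A'_2+I)},\ \frac{(A'_1\widetilde A'_1)^{-1}E_2F_3}{E_3-F_3},\ \frac{E_{n-1}F_n}{E_n-F_n}\right]_{n=4}^{+\infty}.$$ -/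

import Mathlib

open Matrix Filter Topology

noncomputable section

namespace OpDiv

variable {m : ℕ}

/-! ### Matrix continued fractions

`[a 0; b 1 / a 1, b 2 / a 2, …]`, where a quotient `N / D` of matrices means `D⁻¹ * N`. -/

/-- The numerators: `P₋₁ = I`, `P₀ = a₀`, `Pₙ = aₙ Pₙ₋₁ + bₙ Pₙ₋₂`. -/
def cfNum (a b : ℕ → Matrix (Fin m) (Fin m) ℝ) : ℕ → Matrix (Fin m) (Fin m) ℝ
  | 0 => a 0
  | 1 => a 1 * a 0 + b 1
  | n + 2 => a (n + 2) * cfNum a b (n + 1) + b (n + 2) * cfNum a b n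

/-- The denominators: `Q₋₁ = 0`, `Q₀ = I`, `Qₙ = aₙ Qₙ₋₁ + bₙ Qₙ₋₂`. -/
def cfDen (a b : ℕ → Matrix (Fin m) (Fin m) ℝ) : ℕ → Matrix (Fin m) (Fin m) ℝ
  | 0 => 1
  | 1 => a 1
  | n + 2 => a (n + 2) * cfDen a b (n + 1) + b (n + 2) * cfDen a b n

/-- The `n`-th convergent `Pₙ / Qₙ`; it is meaningful when `Qₙ` is invertible. -/
def cfConvergent (a b : ℕ → Matrix (Fin m) (Fin m) ℝ) (n : ℕ) : Matrix (Fin m) (Fin m) ℝ :=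
  (cfDen a b n)⁻¹ * cfNum a b n

/-- The continued fraction is well defined: each of its convergents exists. -/
def CFWellDefined (a b : ℕ → Matrix (Fin m) (Fin m) ℝ) : Prop :=
  ∀ n, IsUnit (cfDen a b n)

/-- The continued fraction converges to `F` (entrywise, equivalently in any matrix norm). -/
def CFConvergesTo (a b : ℕ → Matrix (Fin m) (Fin m) ℝ) (F : Matrix (Fin m) (Fin m) ℝ) : Prop :=
  Tendsto (cfConvergent a b) atTop (𝓝 F)

/-! ### Powers, logarithm and the operator quantities -/

/-- The real power `M ^ s` of a positive definite matrix (functional calculus). -/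
def mpow (M : Matrix (Fin m) (Fin m) ℝ) (s : ℝ) : Matrix (Fin m) (Fin m) ℝ :=
  cfc (fun x : ℝ => x ^ s) M

/-- The logarithm of a positive definite matrix (functional calculus). -/
def mlog (M : Matrix (Fin m) (Fin m) ℝ) : Matrix (Fin m) (Fin m) ℝ :=
  cfc Real.log M

/-- `X = A^{-1/2} B A^{-1/2}`. -/
def relMat (A B : Matrix (Fin m) (Fin m) ℝ) : Matrix (Fin m) (Fin m) ℝ :=
  mpow A (-(1 / 2)) * B * mpow A (-(1 / 2))

/-- The path `f_s(A|B) = A^{1/2} (A^{-1/2} B A^{-1/2})^s A^{1/2}`. -/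
def opPath (s : ℝ) (A B : Matrix (Fin m) (Fin m) ℝ) : Matrix (Fin m) (Fin m) ℝ :=
  mpow A (1 / 2) * mpow (relMat A B) s * mpow A (1 / 2)

/-- The generalized relative operator entropy
`S_q(A|B) = A^{1/2} (A^{-1/2} B A^{-1/2})^q ln (A^{-1/2} B A^{-1/2}) A^{1/2}`. -/
def opEntropy (q : ℝ) (A B : Matrix (Fin m) (Fin m) ℝ) : Matrix (Fin m) (Fin m) ℝ :=
  mpow A (1 / 2) * (mpow (relMat A B) q * mlog (relMat A B)) * mpow A (1 / 2)

/-- The generalized Bregman operator divergence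
`D_q(A|B) = f_{1+q}(A|B) - f_q(A|B) - S_q(A|B)`; here `f_{1+q}(A|B) = f_{-q}(B|A)`. -/
def opDivergence (q : ℝ) (A B : Matrix (Fin m) (Fin m) ℝ) : Matrix (Fin m) (Fin m) ℝ :=
  opPath (1 + q) A B - opPath q A B - opEntropy q A B

/-! ### The coefficients of the expansion -/

/-- `φ(X) = (I - X) / (I + X)`. -/
def phi (X : Matrix (Fin m) (Fin m) ℝ) : Matrix (Fin m) (Fin m) ℝ :=
  (1 + X)⁻¹ * (1 - X)

/-- The coefficients `A'ₙ` of the simple continued fraction `[A'₀; I / A'₁, I / A'₂, …]` of `X^q`: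
`A'₀ = I`, `A'₁ = (2qφ)⁻¹ (-I - qφ)`,
`A'₂ₖ = -2q ∏_{j<k} (q² - (2j)²) / ∏_{j≤k} (q² - (2j-1)²) (4k-1) φ⁻¹` for `k ≥ 1`,
`A'₂ₖ₊₁ = -∏_{j≤k} (q² - (2j-1)²) / (2q ∏_{j≤k} (q² - (2j)²)) (4k+1) φ⁻¹` for `k ≥ 1`. -/
def powCoef (q : ℝ) (X : Matrix (Fin m) (Fin m) ℝ) (n : ℕ) : Matrix (Fin m) (Fin m) ℝ :=
  if n = 0 then 1
  else if n = 1 then ((2 * q) • phi X)⁻¹ * (-1 - q • phi X)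
  else if n % 2 = 0 then
    (-(2 * q) * (∏ j ∈ Finset.Icc 1 (n / 2 - 1), (q ^ 2 - (2 * (j : ℝ)) ^ 2))
      / (∏ j ∈ Finset.Icc 1 (n / 2), (q ^ 2 - (2 * (j : ℝ) - 1) ^ 2))
      * (4 * ((n / 2 : ℕ) : ℝ) - 1)) • (phi X)⁻¹
  else
    (-(∏ j ∈ Finset.Icc 1 (n / 2), (q ^ 2 - (2 * (j : ℝ) - 1) ^ 2))
      / (2 * q * ∏ j ∈ Finset.Icc 1 (n / 2), (q ^ 2 - (2 * (j : ℝ)) ^ 2))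
      * (4 * ((n / 2 : ℕ) : ℝ) + 1)) • (phi X)⁻¹

/-- The coefficients `Ã'ₙ` of the simple continued fraction `[Ã'₀; I / Ã'₁, I / Ã'₂, …]` of
`X - I - ln X`: `Ã'₀ = X - I`,
`Ã'₂ₖ = -2 (2·4⋯(2k-2))² / (1·3⋯(2k-1))² (4k-1) φ⁻¹` for `k ≥ 1`,
`Ã'₂ₖ₊₁ = (1·3⋯(2k-1))² / (2 (2·4⋯2k)²) (4k+1) φ⁻¹` for `k ≥ 0`. -/
def logCoef (X : Matrix (Fin m) (Fin m) ℝ) (n : ℕ) : Matrix (Fin m) (Fin m) ℝ :=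
  if n = 0 then X - 1
  else if n % 2 = 0 then
    (-2 * (∏ j ∈ Finset.Icc 1 (n / 2 - 1), (2 * (j : ℝ))) ^ 2
      / (∏ j ∈ Finset.Icc 1 (n / 2), (2 * (j : ℝ) - 1)) ^ 2
      * (4 * ((n / 2 : ℕ) : ℝ) - 1)) • (phi X)⁻¹
  else
    ((∏ j ∈ Finset.Icc 1 (n / 2), (2 * (j : ℝ) - 1)) ^ 2
      / (2 * (∏ j ∈ Finset.Icc 1 (n / 2), (2 * (j : ℝ))) ^ 2)
      * (4 * ((n / 2 : ℕ) : ℝ) + 1)) • (phi X)⁻¹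

/-- Numerators `Pₙ` of `[A'₀; I / A'₁, I / A'₂, …]`. -/
def powNum (q : ℝ) (X : Matrix (Fin m) (Fin m) ℝ) : ℕ → Matrix (Fin m) (Fin m) ℝ :=
  cfNum (powCoef q X) (fun _ => 1)

/-- Denominators `Qₙ` of `[A'₀; I / A'₁, I / A'₂, …]`. -/
def powDen (q : ℝ) (X : Matrix (Fin m) (Fin m) ℝ) : ℕ → Matrix (Fin m) (Fin m) ℝ :=
  cfDen (powCoef q X) (fun _ => 1)

/-- Numerators `P̃ₙ` of `[Ã'₀; I / Ã'₁, I / Ã'₂, …]`. -/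
def logNum (X : Matrix (Fin m) (Fin m) ℝ) : ℕ → Matrix (Fin m) (Fin m) ℝ :=
  cfNum (logCoef X) (fun _ => 1)

/-- Denominators `Q̃ₙ` of `[Ã'₀; I / Ã'₁, I / Ã'₂, …]`. -/
def logDen (X : Matrix (Fin m) (Fin m) ℝ) : ℕ → Matrix (Fin m) (Fin m) ℝ :=
  cfDen (logCoef X) (fun _ => 1)

/-- `Eₙ = Qₙ Q̃ₙ (Qₙ₋₂ Pₙ₋₁ + Q̃ₙ₋₁ P̃ₙ₋₂)`, used for `n ≥ 2` only. -/
def seqE (q : ℝ) (X : Matrix (Fin m) (Fin m) ℝ) (n : ℕ) : Matrix (Fin m) (Fin m) ℝ :=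
  powDen q X n * logDen X n *
    (powDen q X (n - 2) * powNum q X (n - 1) + logDen X (n - 1) * logNum X (n - 2))

/-- `Fₙ = Qₙ₋₂ Q̃ₙ₋₂ (Qₙ Pₙ₋₁ + Q̃ₙ₋₁ P̃ₙ)`, used for `n ≥ 2` only. -/
def seqF (q : ℝ) (X : Matrix (Fin m) (Fin m) ℝ) (n : ℕ) : Matrix (Fin m) (Fin m) ℝ :=
  powDen q X (n - 2) * logDen X (n - 2) *
    (powDen q X n * powNum q X (n - 1) + logDen X (n - 1) * logNum X n)

/-- The elements `a 0, a 1, a 2, …` (leading term and partial denominators) of the expansion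
of `D_q(A|B)`. -/
def divA (q : ℝ) (A B : Matrix (Fin m) (Fin m) ℝ) : ℕ → Matrix (Fin m) (Fin m) ℝ
  | 0 => B - A
  | 1 => powCoef q (relMat A B) 1 * logCoef (relMat A B) 1 * mpow A (-(1 / 2))
  | 2 =>
    let a := powCoef q (relMat A B)
    let d := logCoef (relMat A B)
    (a 1 * a 2 + a 2 + 1) * d 2 + a 2 * d 0 * (d 1 * d 2 + 1)
  | n + 3 => seqE q (relMat A B) (n + 3) - seqF q (relMat A B) (n + 3)

/-- The partial numerators `b 1, b 2, …` of the expansion of `D_q(A|B)` (`b 0` is not used). -/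
def divB (q : ℝ) (A B : Matrix (Fin m) (Fin m) ℝ) : ℕ → Matrix (Fin m) (Fin m) ℝ
  | 0 => 0
  | 1 =>
    let a := powCoef q (relMat A B)
    let d := logCoef (relMat A B)
    (a 1 + 1 + d 0 * d 1) * mpow A (1 / 2)
  | 2 =>
    let a := powCoef q (relMat A B)
    let d := logCoef (relMat A B)
    ((a 1 * a 2 + 1) * (a 1 + 1) + d 1 * d 2 + d 0 * d 1 * (d 1 * d 2 + 1)) * mpow A (-(1 / 2))
  | 3 =>
    (powCoef q (relMat A B) 1 * logCoef (relMat A B) 1)⁻¹ *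
      seqE q (relMat A B) 2 * seqF q (relMat A B) 3
  | n + 4 => seqE q (relMat A B) (n + 3) * seqF q (relMat A B) (n + 4)

end OpDiv

end

/-!
# Convergence of the continued fraction for the generalized Bregman operator divergence

With `X = A^{-1/2} B A^{-1/2}` one has `D_q(A|B) = A^{1/2} X^q (X - 1 - ln X) A^{1/2}`. The functional
calculus of `X` is an algebra homomorphism `Φ` from `Fin m → ℝ` to matrices (`exists_algHom_cfc`), so
all coefficients built from `X` are values of `Φ` and the problem becomes one about real numbers.

*Algebra.* Let `P n / Q n` and `P̃ n / Q̃ n` be the convergents of the simple continued fractions of `X^q`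
and of `X - 1 - ln X`. The consecutive products `P n P̃ n / (Q n Q̃ n)` differ by `± G n` over the product
of their denominators (`prodNum_mul_sub`), where `G n` is `prodGap`. A continued fraction with
prescribed convergents is determined by these differences up to equivalence, and the elements `Eₙ`, `Fₙ`
are exactly such that the numerators and denominators of the fraction for `D_q` are
`P n P̃ n` and `Q n Q̃ n` times a common factor (`cf_div_eq`). Well-definedness makes that factor
invertible, so the `n`-th convergent is `A^{1/2} (P n P̃ n / (Q n Q̃ n)) A^{1/2}`.

*Analysis.* After an equivalence transformation both fractions are governed by the recurrence
`y (n+2) = (2n+3) y (n+1) + (q² - (n+1)²) φ² y n`, with `φ = (1 - x) / (1 + x)`, and with `q = 0` in the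
case of the logarithm. The integrals `∫ ((1 - t²)/2)^k (1 + tφ)^(q-1-k)` over `[-1, 1]`, suitably
normalized, give a positive minimal solution `eulerMin` of the adjoint recurrence. Pairing it with the
solutions of the recurrence yields an exact error formula (`mul_eulerSeq_sub`) and a lower bound for the
denominators (`eulerSeq_pos_and_le`); since `1 - t² ≤ 2 (1 + tφ)`, the integrals are bounded and the
error is `O(n φ^(2n))` (`tendsto_eulerSeq_div`). The first two terms of `eulerMin` are elementary and
identify the limits as `x^q` and `x - 1 - log x`.
-/

noncomputable section

namespace OpDiv

variable {m : ℕ}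

/-! ### The three-term recurrence and its minimal adjoint solution -/

/-- The solution with `y 0 = y₀`, `y 1 = y₁` of the recurrence satisfied, after clearing denominators, by
the numerators and denominators of Gauss's continued fractions for `((1 - φ) / (1 + φ)) ^ q` and, with
`q = 0`, for `log ((1 - φ) / (1 + φ))`. The index is shifted by one against the convergents of the tail
`1 + (q² - 1)φ² / (3 + (q² - 4)φ² / (5 + ⋯))`, whose numerators and denominators are the solutions
starting with `1, 1` and `0, 1`. -/
def eulerSeq (q φ y₀ y₁ : ℝ) : ℕ → ℝ
  | 0 => y₀
  | 1 => y₁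
  | n + 2 => (2 * n + 3) * eulerSeq q φ y₀ y₁ (n + 1)
      + (q ^ 2 - (n + 1) ^ 2) * φ ^ 2 * eulerSeq q φ y₀ y₁ n

lemma eulerSeq_eq_add (q φ y₀ y₁ : ℝ) (n : ℕ) :
    eulerSeq q φ y₀ y₁ n = y₀ * eulerSeq q φ 1 1 n + (y₁ - y₀) * eulerSeq q φ 0 1 n := by
  induction n using Nat.twoStepInduction with
  | zero => simp [eulerSeq]
  | one => simp [eulerSeq]
  | more n h₀ h₁ => simp only [eulerSeq, h₀, h₁]; ring

section Minimal

variable {q φ : ℝ} {g : ℕ → ℝ}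

/-- The Casoratian-type pairing of a solution `g` of the adjoint recurrence with the solution starting
with `1, 1` is constant. -/
lemma eulerSeq_mul_sub
    (hg : ∀ k, g k = (2 * k + 1) * g (k + 1) - ((k + 1) ^ 2 - q ^ 2) * φ ^ 2 * g (k + 2)) (k : ℕ) :
    eulerSeq q φ 1 1 (k + 1) * g (k + 1)
      - ((k + 1) ^ 2 - q ^ 2) * φ ^ 2 * eulerSeq q φ 1 1 k * g (k + 2) = g 0 := by
  induction k with
  | zero => have := hg 0; simp [eulerSeq] at this ⊢; linarith
  | succ k ih =>
    rw [← ih, hg (k + 1)]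
    simp only [eulerSeq]
    push_cast
    ring

/-- Exact error formula: `g 1 / g 0` misses the quotient of the two basic solutions by a multiple of
`g (k + 1)`, the factor being the product of the (negated) partial numerators. -/
lemma mul_eulerSeq_sub
    (hg : ∀ k, g k = (2 * k + 1) * g (k + 1) - ((k + 1) ^ 2 - q ^ 2) * φ ^ 2 * g (k + 2)) (k : ℕ) :
    g 0 * eulerSeq q φ 0 1 k - g 1 * eulerSeq q φ 1 1 k
      = -((∏ j ∈ Finset.range k, (((j : ℝ) + 1) ^ 2 - q ^ 2) * φ ^ 2) * g (k + 1)) := by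
  induction k using Nat.twoStepInduction with
  | zero => simp [eulerSeq]
  | one => have := hg 0; simp [eulerSeq] at this ⊢; linarith
  | more k h₀ h₁ =>
    have h := hg (k + 1)
    rw [Finset.prod_range_succ] at h₁
    rw [Finset.prod_range_succ, Finset.prod_range_succ]
    simp only [eulerSeq]
    push_cast at h h₁ ⊢
    rw [h] at h₀
    linear_combination (2 * (k : ℝ) + 3) * h₁ + (q ^ 2 - (k + 1) ^ 2) * φ ^ 2 * h₀

/-- For `0 ≤ q < 1` both terms of the pairing have a definite sign, which bounds the solution from
below. -/
lemma eulerSeq_pos_and_le (hq : 0 ≤ q) (hq1 : q < 1) (hpos : ∀ k, 0 < g k)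
    (hg : ∀ k, g k = (2 * k + 1) * g (k + 1) - ((k + 1) ^ 2 - q ^ 2) * φ ^ 2 * g (k + 2)) (k : ℕ) :
    0 < eulerSeq q φ 1 1 k ∧ g 0 ≤ eulerSeq q φ 1 1 k * g k := by
  induction k with
  | zero => simp [eulerSeq]
  | succ k ih =>
    have h := eulerSeq_mul_sub hg k
    have hb : 0 ≤ ((k + 1 : ℝ) ^ 2 - q ^ 2) * φ ^ 2 * eulerSeq q φ 1 1 k * g (k + 2) := by
      have : 0 ≤ (k + 1 : ℝ) ^ 2 - q ^ 2 := by
        have : (0 : ℝ) ≤ k := k.cast_nonneg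
        nlinarith
      have := ih.1
      have := hpos (k + 2)
      positivity
    have h2 : g 0 ≤ eulerSeq q φ 1 1 (k + 1) * g (k + 1) := by linarith
    exact ⟨pos_of_mul_pos_left ((hpos 0).trans_le h2) (hpos _).le, h2⟩

end Minimal

/-! ### Integral representation of the minimal solution -/

/-- The integral representing, up to normalization, the hypergeometric function
`₂F₁((k+1-q)/2, (k+2-q)/2; k+3/2; φ²)` that occurs in Gauss's continued fraction. -/
def eulerInt (q φ : ℝ) (k : ℕ) : ℝ :=
  ∫ t in (-1 : ℝ)..1, ((1 - t ^ 2) / 2) ^ k * (1 + t * φ) ^ (q - 1 - k)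

section Integral

variable {q φ : ℝ}

lemma one_add_mul_pos (h : |φ| < 1) {t : ℝ} (ht : t ∈ Set.Icc (-1 : ℝ) 1) : 0 < 1 + t * φ := by
  have h1 := abs_lt.1 h
  have h2 : |t * φ| < 1 := by
    rw [abs_mul]
    exact (mul_le_of_le_one_left (abs_nonneg φ) (abs_le.2 ht)).trans_lt h
  linarith [abs_lt.1 h2]

lemma continuousOn_rpow_one_add_mul (h : |φ| < 1) (s : ℝ) :
    ContinuousOn (fun t : ℝ => (1 + t * φ) ^ s) (Set.Icc (-1) 1) :=
  ContinuousOn.rpow_const (by fun_prop) fun _ ht => Or.inl (one_add_mul_pos h ht).ne'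

lemma intervalIntegrable_eulerInt (h : |φ| < 1) (s : ℝ) (k : ℕ) :
    IntervalIntegrable (fun t : ℝ => ((1 - t ^ 2) / 2) ^ k * (1 + t * φ) ^ s)
      MeasureTheory.volume (-1) 1 := by
  apply ContinuousOn.intervalIntegrable
  rw [Set.uIcc_of_le (by norm_num)]
  exact ContinuousOn.mul (by fun_prop) (continuousOn_rpow_one_add_mul h s)

lemma rpow_eq_mul_rpow_sub_one {u : ℝ} (hu : 0 < u) (s : ℝ) : u ^ s = u * u ^ (s - 1) := by
  rw [Real.rpow_sub_one hu.ne']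
  field_simp

lemma hasDerivAt_one_sub_sq_div_two (t : ℝ) :
    HasDerivAt (fun t : ℝ => (1 - t ^ 2) / 2) (-t) t :=
  (((hasDerivAt_pow 2 t).const_sub 1).div_const 2).congr_deriv (by norm_num; ring)

lemma hasDerivAt_one_add_mul (φ t : ℝ) : HasDerivAt (fun t : ℝ => 1 + t * φ) φ t := by
  simpa using ((hasDerivAt_id' t).mul_const φ).const_add 1

lemma eulerInt_pos (h : |φ| < 1) (k : ℕ) : 0 < eulerInt q φ k := by
  apply intervalIntegral.intervalIntegral_pos_of_pos_on (intervalIntegrable_eulerInt h _ k) _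
    (by norm_num)
  intro t ht
  have h1 := one_add_mul_pos h (Set.Ioo_subset_Icc_self ht)
  have h2 : 0 < 1 - t ^ 2 := by nlinarith [ht.1, ht.2]
  positivity

/-- The integrals decrease in `k`, because `1 - t² ≤ 2 (1 + tφ)`; this is
`0 ≤ (t + φ)² + (1 - φ²)`. -/
lemma eulerInt_succ_le (h : |φ| < 1) (k : ℕ) : eulerInt q φ (k + 1) ≤ eulerInt q φ k := by
  apply intervalIntegral.integral_mono_on (by norm_num) (intervalIntegrable_eulerInt h _ _)
    (intervalIntegrable_eulerInt h _ _)
  intro t ht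
  have h1 := one_add_mul_pos h ht
  have h2 : 0 ≤ 1 - t ^ 2 := by nlinarith [ht.1, ht.2]
  have h3 : (1 - t ^ 2) / 2 ≤ 1 + t * φ := by
    nlinarith [sq_nonneg (t + φ), abs_lt.1 h, sq_abs φ, abs_nonneg φ]
  have h4 : (1 + t * φ) ^ (q - 1 - k) = (1 + t * φ) * (1 + t * φ) ^ (q - 1 - (k + 1 : ℕ)) := by
    rw [rpow_eq_mul_rpow_sub_one h1]
    congr 2; push_cast; ring
  rw [h4, pow_succ, mul_assoc]
  gcongr

lemma eulerInt_le (h : |φ| < 1) (k : ℕ) : eulerInt q φ k ≤ eulerInt q φ 0 :=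
  (antitone_nat_of_succ_le (eulerInt_succ_le h)) (Nat.zero_le k)

/-- The contiguous relation between three consecutive integrals: the corresponding combination of
integrands is the derivative of a function vanishing at `t = ±1`. -/
lemma eulerInt_rec (h : |φ| < 1) (k : ℕ) :
    ((k : ℝ) + 1) * (k + 2) * eulerInt q φ k - (2 * k + 3) * (k + 2) * eulerInt q φ (k + 1)
      + ((k + 2) ^ 2 - q ^ 2) * φ ^ 2 * eulerInt q φ (k + 2) = 0 := by
  -- With `v = (1 - t²)/2` and `u = 1 + tφ`, the antiderivative is `v^(k+1) u^(q-k-2) L`; the quadratic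
  -- `L` is found by comparing both sides at `v = 0` and their leading coefficients in `t`.
  have hd : ∀ t ∈ Set.uIcc (-1 : ℝ) 1, HasDerivAt
      (fun t : ℝ => ((1 - t ^ 2) / 2) ^ (k + 1) * (1 + t * φ) ^ (q - 1 - (k + 1 : ℕ)) *
        (-(k + 2) * (t + φ) + (k + 2 - q) * φ * ((1 - t ^ 2) / 2)))
      (((k : ℝ) + 1) * (k + 2) * (((1 - t ^ 2) / 2) ^ k * (1 + t * φ) ^ (q - 1 - k))
        - (2 * k + 3) * (k + 2) *
          (((1 - t ^ 2) / 2) ^ (k + 1) * (1 + t * φ) ^ (q - 1 - (k + 1 : ℕ)))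
        + ((k + 2) ^ 2 - q ^ 2) * φ ^ 2 *
          (((1 - t ^ 2) / 2) ^ (k + 2) * (1 + t * φ) ^ (q - 1 - (k + 2 : ℕ)))) t := by
    intro t ht
    rw [Set.uIcc_of_le (by norm_num)] at ht
    have hu := one_add_mul_pos h ht
    have hv := hasDerivAt_one_sub_sq_div_two t
    have hu' := hasDerivAt_one_add_mul φ t
    have hL : HasDerivAt (fun t : ℝ => -((k : ℝ) + 2) * (t + φ)
        + (k + 2 - q) * φ * ((1 - t ^ 2) / 2)) (-((k : ℝ) + 2) * 1 + (k + 2 - q) * φ * (-t)) t :=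
      (((hasDerivAt_id' t).add_const φ).const_mul (-((k : ℝ) + 2))).fun_add
        (hv.const_mul ((k + 2 - q) * φ))
    refine (((hv.fun_pow (k + 1)).fun_mul
      (hu'.rpow_const (p := q - 1 - (k + 1 : ℕ)) (Or.inl hu.ne'))).fun_mul hL).congr_deriv ?_
    have e0 : (1 + t * φ) ^ (q - 1 - k)
        = (1 + t * φ) ^ 2 * (1 + t * φ) ^ (q - 1 - (k + 2 : ℕ)) := by
      rw [← Real.rpow_natCast, ← Real.rpow_add hu]
      congr 1; push_cast; ring
    have e1 : (1 + t * φ) ^ (q - 1 - (k + 1 : ℕ))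
        = (1 + t * φ) * (1 + t * φ) ^ (q - 1 - (k + 2 : ℕ)) := by
      rw [rpow_eq_mul_rpow_sub_one hu]
      congr 2; push_cast; ring
    have e2 : (1 + t * φ) ^ (q - 1 - (k + 1 : ℕ) - 1)
        = (1 + t * φ) ^ (q - 1 - (k + 2 : ℕ)) := by
      congr 1; push_cast; ring
    rw [e0, e2, e1]
    simp only [Nat.add_sub_cancel]
    push_cast
    ring
  have hi := intervalIntegrable_eulerInt (φ := φ) h
  have := intervalIntegral.integral_eq_sub_of_hasDerivAt hd
    ((((hi _ _).const_mul _).sub ((hi _ _).const_mul _)).add ((hi _ _).const_mul _))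
  rw [intervalIntegral.integral_add (((hi _ _).const_mul _).sub ((hi _ _).const_mul _))
    ((hi _ _).const_mul _), intervalIntegral.integral_sub ((hi _ _).const_mul _)
    ((hi _ _).const_mul _)] at this
  simp only [intervalIntegral.integral_const_mul] at this
  rw [eulerInt, eulerInt, eulerInt, this]
  simp

/-- The contiguous relation one step below `eulerInt_rec`: here the antiderivative does not vanish at the
end points, and its boundary values replace the missing integral. -/
lemma eulerInt_zero_sub (h : |φ| < 1) :
    eulerInt q φ 0 - (1 - q ^ 2) * φ ^ 2 * eulerInt q φ 1 = (1 + φ) ^ q + (1 - φ) ^ q := by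
  have hd : ∀ t ∈ Set.uIcc (-1 : ℝ) 1, HasDerivAt
      (fun t : ℝ => (1 + t * φ) ^ (q - 1) * ((t + φ) - (1 - q) * φ * ((1 - t ^ 2) / 2)))
      (((1 - t ^ 2) / 2) ^ 0 * (1 + t * φ) ^ (q - 1 - (0 : ℕ)) - (1 - q ^ 2) * φ ^ 2 *
        (((1 - t ^ 2) / 2) ^ 1 * (1 + t * φ) ^ (q - 1 - (1 : ℕ)))) t := by
    intro t ht
    rw [Set.uIcc_of_le (by norm_num)] at ht
    have hu := one_add_mul_pos h ht
    have hv := hasDerivAt_one_sub_sq_div_two t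
    have hu' := hasDerivAt_one_add_mul φ t
    have hL : HasDerivAt (fun t : ℝ => (t + φ) - (1 - q) * φ * ((1 - t ^ 2) / 2))
        (1 - (1 - q) * φ * (-t)) t :=
      ((hasDerivAt_id' t).add_const φ).fun_sub (hv.const_mul ((1 - q) * φ))
    refine ((hu'.rpow_const (p := q - 1) (Or.inl hu.ne')).fun_mul hL).congr_deriv ?_
    simp only [Nat.cast_zero, Nat.cast_one, sub_zero]
    rw [rpow_eq_mul_rpow_sub_one hu (q - 1)]
    ring
  have hi := intervalIntegrable_eulerInt (φ := φ) h
  have := intervalIntegral.integral_eq_sub_of_hasDerivAt hd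
    ((hi _ _).sub ((hi _ _).const_mul _))
  rw [intervalIntegral.integral_sub (hi _ _) ((hi _ _).const_mul _)] at this
  simp only [intervalIntegral.integral_const_mul] at this
  rw [eulerInt, eulerInt, this]
  obtain ⟨h1, h2⟩ := abs_lt.1 h
  have e1 : (1 + φ) ^ q = (1 + φ) ^ (q - 1) * (1 + φ) := by
    rw [← Real.rpow_add_one (by linarith)]; congr 1; ring
  have e2 : (1 - φ) ^ q = (1 - φ) ^ (q - 1) * (1 - φ) := by
    rw [← Real.rpow_add_one (by linarith)]; congr 1; ring
  rw [e1, e2, one_mul, show 1 + -1 * φ = 1 - φ by ring]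
  ring

lemma eulerInt_zero (h : |φ| < 1) :
    q * φ * eulerInt q φ 0 = (1 + φ) ^ q - (1 - φ) ^ q := by
  have hd : ∀ t ∈ Set.uIcc (-1 : ℝ) 1, HasDerivAt (fun t : ℝ => (1 + t * φ) ^ q)
      (q * φ * (((1 - t ^ 2) / 2) ^ 0 * (1 + t * φ) ^ (q - 1 - (0 : ℕ)))) t := by
    intro t ht
    rw [Set.uIcc_of_le (by norm_num)] at ht
    have hu' := hasDerivAt_one_add_mul φ t
    refine (hu'.rpow_const (p := q) (Or.inl (one_add_mul_pos h ht).ne')).congr_deriv ?_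
    rw [pow_zero, Nat.cast_zero, sub_zero]
    ring
  have := intervalIntegral.integral_eq_sub_of_hasDerivAt hd
    ((intervalIntegrable_eulerInt h _ _).const_mul _)
  rw [intervalIntegral.integral_const_mul] at this
  rw [eulerInt, this]
  norm_num [sub_eq_add_neg]

lemma eulerInt_zero_zero (h : |φ| < 1) :
    φ * eulerInt 0 φ 0 = Real.log (1 + φ) - Real.log (1 - φ) := by
  have hd : ∀ t ∈ Set.uIcc (-1 : ℝ) 1, HasDerivAt (fun t : ℝ => Real.log (1 + t * φ))
      (φ * (((1 - t ^ 2) / 2) ^ 0 * (1 + t * φ) ^ ((0 : ℝ) - 1 - (0 : ℕ)))) t := by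
    intro t ht
    rw [Set.uIcc_of_le (by norm_num)] at ht
    have hu' := hasDerivAt_one_add_mul φ t
    refine (hu'.log (one_add_mul_pos h ht).ne').congr_deriv ?_
    norm_num [Real.rpow_neg_one, div_eq_mul_inv]
  have := intervalIntegral.integral_eq_sub_of_hasDerivAt hd
    ((intervalIntegrable_eulerInt h _ _).const_mul _)
  rw [intervalIntegral.integral_const_mul] at this
  rw [eulerInt, this]
  norm_num [sub_eq_add_neg]

end Integral

/-- The minimal solution of the adjoint recurrence `eulerMin_rec`. Its ratio `eulerMin 1 / eulerMin 0`
is `tanh (q artanh φ) / (qφ)`, respectively `artanh φ / φ` for `q = 0`. -/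
def eulerMin (q φ : ℝ) : ℕ → ℝ
  | 0 => ((1 + φ) ^ q + (1 - φ) ^ q) / 2
  | k + 1 => eulerInt q φ k / (2 * k.factorial)

lemma eulerMin_rec {q φ : ℝ} (h : |φ| < 1) (k : ℕ) :
    eulerMin q φ k = (2 * k + 1) * eulerMin q φ (k + 1)
      - ((k + 1) ^ 2 - q ^ 2) * φ ^ 2 * eulerMin q φ (k + 2) := by
  cases k with
  | zero =>
    have := eulerInt_zero_sub (q := q) h
    simp [eulerMin]
    linarith
  | succ k =>
    have := eulerInt_rec (q := q) h k
    have h3 : (k.factorial : ℝ) ≠ 0 := by positivity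
    simp only [eulerMin, Nat.factorial_succ]
    push_cast
    field_simp
    linear_combination this

lemma eulerMin_pos {q φ : ℝ} (h : |φ| < 1) (k : ℕ) : 0 < eulerMin q φ k := by
  obtain ⟨h1, h2⟩ := abs_lt.1 h
  cases k with
  | zero =>
    have := Real.rpow_pos_of_pos (show 0 < 1 + φ by linarith) q
    have := Real.rpow_pos_of_pos (show 0 < 1 - φ by linarith) q
    simp only [eulerMin]; positivity
  | succ k =>
    have := eulerInt_pos (q := q) h k
    simp only [eulerMin]; positivity

/-- The tail of Gauss's continued fraction converges, with error `O(n φ^(2n))`. -/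
lemma tendsto_eulerSeq_div {q φ : ℝ} (hq : 0 ≤ q) (hq1 : q < 1) (h : |φ| < 1) :
    Tendsto (fun n => eulerSeq q φ 0 1 n / eulerSeq q φ 1 1 n) atTop
      (𝓝 (eulerMin q φ 1 / eulerMin q φ 0)) := by
  have hφ2 : φ ^ 2 < 1 := (sq_lt_one_iff_abs_lt_one φ).2 h
  set g := eulerMin q φ with hg
  have hpos : ∀ k, 0 < g k := eulerMin_pos h
  have hrec := eulerMin_rec (q := q) h
  set c := eulerInt q φ 0 with hc
  have hlim : Tendsto (fun k : ℕ => (c / 2) ^ 2 / g 0 ^ 2 * ((k : ℝ) * (φ ^ 2) ^ k)) atTop (𝓝 0) := by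
    have := tendsto_self_mul_const_pow_of_lt_one (sq_nonneg φ) hφ2
    simpa using this.const_mul ((c / 2) ^ 2 / g 0 ^ 2)
  rw [tendsto_iff_norm_sub_tendsto_zero]
  refine squeeze_zero' (Eventually.of_forall fun _ => norm_nonneg _) ?_ hlim
  filter_upwards [eventually_ge_atTop 1] with k hk
  obtain ⟨hA, hle⟩ := eulerSeq_pos_and_le hq hq1 hpos hrec k
  have hprod0 : ∀ j : ℕ, 0 ≤ (((j : ℝ) + 1) ^ 2 - q ^ 2) * φ ^ 2 := fun j => by
    have : (0 : ℝ) ≤ j := j.cast_nonneg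
    have : 0 ≤ ((j : ℝ) + 1) ^ 2 - q ^ 2 := by nlinarith
    positivity
  have hprod : ∏ j ∈ Finset.range k, (((j : ℝ) + 1) ^ 2 - q ^ 2) * φ ^ 2
      ≤ (k.factorial : ℝ) ^ 2 * (φ ^ 2) ^ k := by
    calc _ ≤ ∏ j ∈ Finset.range k, ((j : ℝ) + 1) ^ 2 * φ ^ 2 :=
          Finset.prod_le_prod (fun j _ => hprod0 j) fun j _ => by gcongr; nlinarith
      _ = _ := by
          rw [Finset.prod_mul_distrib, Finset.prod_pow, ← Finset.prod_range_add_one_eq_factorial,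
            Finset.prod_const, Finset.card_range]
          push_cast
          rfl
  -- The factorials in the product of partial numerators and in the normalization of `g` cancel up to a
  -- factor `k`.
  have hgk : g k * g (k + 1) ≤ (c / 2) ^ 2 * k / (k.factorial : ℝ) ^ 2 := by
    obtain ⟨k, rfl⟩ : ∃ l, k = l + 1 := ⟨k - 1, by omega⟩
    have h1 := eulerInt_le (q := q) h k
    have h2 := eulerInt_le (q := q) h (k + 1)
    have h3 := eulerInt_pos (q := q) h k
    have h4 := eulerInt_pos (q := q) h (k + 1)
    calc g (k + 1) * g (k + 1 + 1)
        ≤ (c / (2 * k.factorial)) * (c / (2 * (k + 1).factorial)) := by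
          have hc0 : 0 < c := eulerInt_pos h 0
          simp only [hg, eulerMin]; gcongr
      _ = _ := by
          rw [Nat.factorial_succ]; push_cast; field_simp
  have hdiff : eulerSeq q φ 0 1 k / eulerSeq q φ 1 1 k - g 1 / g 0
      = -((∏ j ∈ Finset.range k, (((j : ℝ) + 1) ^ 2 - q ^ 2) * φ ^ 2) * g (k + 1)
        / (g 0 * eulerSeq q φ 1 1 k)) := by
    have := mul_eulerSeq_sub hrec k
    have := (hpos 0).ne'
    field_simp
    linarith
  rw [hdiff, norm_neg, Real.norm_of_nonneg (by
    have := hpos (k + 1); have := hpos 0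
    have := Finset.prod_nonneg fun j (_ : j ∈ Finset.range k) => hprod0 j
    positivity)]
  have h0 := hpos 0
  have hk0 := hpos k
  calc _ ≤ (∏ j ∈ Finset.range k, (((j : ℝ) + 1) ^ 2 - q ^ 2) * φ ^ 2) * g (k + 1)
        / (g 0 * (g 0 / g k)) := by
        have := hpos (k + 1)
        have := Finset.prod_nonneg fun j (_ : j ∈ Finset.range k) => hprod0 j
        gcongr
        rwa [div_le_iff₀ hk0]
    _ = (∏ j ∈ Finset.range k, (((j : ℝ) + 1) ^ 2 - q ^ 2) * φ ^ 2) * (g k * g (k + 1))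
        / g 0 ^ 2 := by rw [← mul_div_assoc, div_div_eq_mul_div]; ring
    _ ≤ ((k.factorial : ℝ) ^ 2 * (φ ^ 2) ^ k) * ((c / 2) ^ 2 * k / (k.factorial : ℝ) ^ 2)
        / g 0 ^ 2 := by
        have := hpos (k + 1)
        gcongr
    _ = _ := by
        have : (k.factorial : ℝ) ≠ 0 := by positivity
        field_simp

lemma tendsto_eulerSeq_rpow {q x : ℝ} (hq : 0 < q) (hq1 : q < 1) (hx : 0 < x) (hx1 : x ≠ 1) :
    Tendsto (fun n => eulerSeq q ((1 - x) / (1 + x)) 1 (1 - q * ((1 - x) / (1 + x))) n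
      / eulerSeq q ((1 - x) / (1 + x)) 1 (1 + q * ((1 - x) / (1 + x))) n) atTop (𝓝 (x ^ q)) := by
  set φ := (1 - x) / (1 + x) with hφ
  have hφ0 : φ ≠ 0 := div_ne_zero (sub_ne_zero.2 hx1.symm) (by positivity)
  have h : |φ| < 1 := by
    rw [hφ, abs_lt, lt_div_iff₀ (by positivity), div_lt_one (by positivity)]
    constructor <;> linarith
  obtain ⟨h1, h2⟩ := abs_lt.1 h
  have hxφ : x = (1 - φ) / (1 + φ) := by rw [hφ]; field_simp; ring
  have hlim := tendsto_eulerSeq_div hq.le hq1 h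
  have hI := eulerInt_zero (q := q) h
  have hp := Real.rpow_pos_of_pos (show 0 < 1 + φ by linarith) q
  have hm := Real.rpow_pos_of_pos (show 0 < 1 - φ by linarith) q
  have hτ : q * φ * (eulerMin q φ 1 / eulerMin q φ 0)
      = ((1 + φ) ^ q - (1 - φ) ^ q) / ((1 + φ) ^ q + (1 - φ) ^ q) := by
    rw [← hI]; simp [eulerMin]; field_simp
  have hne : 1 + q * φ * (eulerMin q φ 1 / eulerMin q φ 0) ≠ 0 := by
    rw [hτ]
    have : 1 + ((1 + φ) ^ q - (1 - φ) ^ q) / ((1 + φ) ^ q + (1 - φ) ^ q)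
      = 2 * (1 + φ) ^ q / ((1 + φ) ^ q + (1 - φ) ^ q) := by field_simp; ring
    rw [this]; positivity
  have hval : x ^ q = (1 - q * φ * (eulerMin q φ 1 / eulerMin q φ 0))
      / (1 + q * φ * (eulerMin q φ 1 / eulerMin q φ 0)) := by
    rw [eq_div_iff hne, hτ, hxφ, Real.div_rpow (by linarith) (by linarith)]
    field_simp
    ring
  rw [hval]
  refine (((hlim.const_mul (q * φ)).const_sub 1).div
    ((hlim.const_mul (q * φ)).const_add 1) hne).congr fun n => ?_
  have hA := (eulerSeq_pos_and_le hq.le hq1 (eulerMin_pos h) (eulerMin_rec (q := q) h) n).1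
  rw [eulerSeq_eq_add q φ 1 (1 - q * φ), eulerSeq_eq_add q φ 1 (1 + q * φ),
    ← div_div_div_cancel_right₀ hA.ne' _ (1 * eulerSeq q φ 1 1 n + _), Pi.div_apply]
  congr 1 <;> (field_simp; ring)

lemma tendsto_eulerSeq_log {x : ℝ} (hx : 0 < x) :
    Tendsto (fun n => eulerSeq 0 ((1 - x) / (1 + x)) (x - 1) (x - 1 + 2 * ((1 - x) / (1 + x))) n
      / eulerSeq 0 ((1 - x) / (1 + x)) 1 1 n) atTop (𝓝 (x - 1 - Real.log x)) := by
  set φ := (1 - x) / (1 + x) with hφ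
  have h : |φ| < 1 := by
    rw [hφ, abs_lt, lt_div_iff₀ (by positivity), div_lt_one (by positivity)]
    constructor <;> linarith
  obtain ⟨h1, h2⟩ := abs_lt.1 h
  have hxφ : x = (1 - φ) / (1 + φ) := by rw [hφ]; field_simp; ring
  have hlim := tendsto_eulerSeq_div le_rfl one_pos h
  have hval : x - 1 - Real.log x = x - 1 + 2 * φ * (eulerMin 0 φ 1 / eulerMin 0 φ 0) := by
    have := eulerInt_zero_zero h
    have h3 : Real.log x = Real.log (1 - φ) - Real.log (1 + φ) := by
      conv_lhs => rw [hxφ]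
      rw [Real.log_div (by linarith) (by linarith)]
    rw [h3]
    simp [eulerMin]
    linarith
  rw [hval]
  refine ((hlim.const_mul (2 * φ)).const_add (x - 1)).congr fun n => ?_
  have hA := (eulerSeq_pos_and_le le_rfl one_pos (eulerMin_pos h) (eulerMin_rec (q := 0) h) n).1
  rw [eulerSeq_eq_add 0 φ (x - 1)]
  field_simp
  ring

/-! ### Simple continued fractions and the scalar coefficients -/

/-- The solution with `y 0 = y₀`, `y 1 = y₁` of the recurrence `y (n+2) = a (n+2) y (n+1) + y n` of a
simple continued fraction. It is set in a commutative ring, so as to be used both in `ℝ` and in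
`Fin m → ℝ`. -/
def contSeq {R : Type*} [CommRing R] (a : ℕ → R) (y₀ y₁ : R) : ℕ → R
  | 0 => y₀
  | 1 => y₁
  | n + 2 => a (n + 2) * contSeq a y₀ y₁ (n + 1) + contSeq a y₀ y₁ n

/-- The numerators of the simple continued fraction `[a 0; 1 / a 1, 1 / a 2, …]`. -/
def simpleNum {R : Type*} [CommRing R] (a : ℕ → R) : ℕ → R := contSeq a (a 0) (a 1 * a 0 + 1)

/-- The denominators of the simple continued fraction `[a 0; 1 / a 1, 1 / a 2, …]`. -/
def simpleDen {R : Type*} [CommRing R] (a : ℕ → R) : ℕ → R := contSeq a 1 (a 1)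

lemma contSeq_pi_apply {ι : Type*} (a : ℕ → ι → ℝ) (y₀ y₁ : ι → ℝ) (n : ℕ) (i : ι) :
    contSeq a y₀ y₁ n i = contSeq (fun k => a k i) (y₀ i) (y₁ i) n := by
  induction n using Nat.twoStepInduction with
  | zero => rfl
  | one => rfl
  | more n h₀ h₁ => simp only [contSeq, Pi.add_apply, Pi.mul_apply, h₀, h₁]

/-- The equivalence transformation: with `c (n+1) c (n+2) (q² - (n+1)²) = 1`, multiplying `eulerSeq` by the
product of the `c j / φ` turns its partial numerators into ones. -/
lemma contSeq_eq_prod_mul_eulerSeq {q φ : ℝ} (hφ : φ ≠ 0) {a c : ℕ → ℝ}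
    (ha : ∀ n : ℕ, a (n + 2) = c (n + 2) * (2 * n + 3) / φ)
    (hc : ∀ n : ℕ, c (n + 1) * c (n + 2) * (q ^ 2 - (n + 1) ^ 2) = 1) (y₀ y₁ : ℝ) (n : ℕ) :
    contSeq a y₀ (c 1 / φ * y₁) n = (∏ j ∈ Finset.range n, c (j + 1) / φ) * eulerSeq q φ y₀ y₁ n := by
  induction n using Nat.twoStepInduction with
  | zero => simp [contSeq, eulerSeq]
  | one => simp [contSeq, eulerSeq]
  | more n h₀ h₁ =>
    simp only [contSeq, eulerSeq, h₀, h₁, ha, Finset.prod_range_succ]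
    field_simp
    linear_combination (-(∏ j ∈ Finset.range n, c (j + 1) / φ) * φ ^ 2
      * eulerSeq q φ y₀ y₁ n) * hc n

lemma prod_div_ne_zero_of_mul_eq_one {q φ : ℝ} (hφ : φ ≠ 0) {c : ℕ → ℝ}
    (hc : ∀ n : ℕ, c (n + 1) * c (n + 2) * (q ^ 2 - (n + 1) ^ 2) = 1) (n : ℕ) :
    ∏ j ∈ Finset.range n, c (j + 1) / φ ≠ 0 :=
  Finset.prod_ne_zero_iff.2 fun j _ => div_ne_zero (fun h => by simpa [h] using hc j) hφ

/-- The scaling factor in the coefficients `A'ₙ`: they are `powScale q n * (2n-1) • φ⁻¹` for `n ≥ 2`. -/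
def powScale (q : ℝ) (n : ℕ) : ℝ :=
  if n % 2 = 0 then
    -(2 * q) * (∏ j ∈ Finset.Icc 1 (n / 2 - 1), (q ^ 2 - (2 * (j : ℝ)) ^ 2))
      / (∏ j ∈ Finset.Icc 1 (n / 2), (q ^ 2 - (2 * (j : ℝ) - 1) ^ 2))
  else
    -(∏ j ∈ Finset.Icc 1 (n / 2), (q ^ 2 - (2 * (j : ℝ) - 1) ^ 2))
      / (2 * q * ∏ j ∈ Finset.Icc 1 (n / 2), (q ^ 2 - (2 * (j : ℝ)) ^ 2))

/-- The scaling factor in the coefficients `Ã'ₙ`: they are `logScale n * (2n-1) • φ⁻¹` for `n ≥ 1`. -/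
def logScale (n : ℕ) : ℝ :=
  if n % 2 = 0 then
    -2 * (∏ j ∈ Finset.Icc 1 (n / 2 - 1), (2 * (j : ℝ))) ^ 2
      / (∏ j ∈ Finset.Icc 1 (n / 2), (2 * (j : ℝ) - 1)) ^ 2
  else
    (∏ j ∈ Finset.Icc 1 (n / 2), (2 * (j : ℝ) - 1)) ^ 2
      / (2 * (∏ j ∈ Finset.Icc 1 (n / 2), (2 * (j : ℝ))) ^ 2)

lemma powScale_mul {q : ℝ} (hq : 0 < q) (hq1 : q < 1) (n : ℕ) :
    powScale q (n + 1) * powScale q (n + 2) * (q ^ 2 - (n + 1) ^ 2) = 1 := by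
  have hne : ∀ r : ℝ, 1 ≤ r → q ^ 2 - r ^ 2 ≠ 0 := fun r hr => by nlinarith
  have he : ∀ k : ℕ, ∏ j ∈ Finset.Icc 1 k, (q ^ 2 - (2 * (j : ℝ)) ^ 2) ≠ 0 := fun k =>
    Finset.prod_ne_zero_iff.2 fun j hj => hne _ (by
      have : (1 : ℝ) ≤ j := by exact_mod_cast (Finset.mem_Icc.1 hj).1
      linarith)
  have ho : ∀ k : ℕ, ∏ j ∈ Finset.Icc 1 k, (q ^ 2 - (2 * (j : ℝ) - 1) ^ 2) ≠ 0 := fun k =>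
    Finset.prod_ne_zero_iff.2 fun j hj => hne _ (by
      have : (1 : ℝ) ≤ j := by exact_mod_cast (Finset.mem_Icc.1 hj).1
      linarith)
  obtain ⟨k, rfl | rfl⟩ := Nat.even_or_odd' n
  · have h1 := he k
    have h2 := ho (k + 1)
    simp only [powScale, show (2 * k + 1) % 2 ≠ 0 by omega, show (2 * k + 2) % 2 = 0 by omega,
      show (2 * k + 1) / 2 = k by omega, show (2 * k + 2) / 2 = k + 1 by omega,
      Nat.add_sub_cancel, if_true, if_false]
    rw [Finset.prod_Icc_succ_top (by omega)] at h2 ⊢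
    obtain ⟨h3, h4⟩ := mul_ne_zero_iff.1 h2
    generalize (∏ j ∈ Finset.Icc 1 k, (q ^ 2 - (2 * (j : ℝ)) ^ 2)) = u at h1 ⊢
    generalize (∏ j ∈ Finset.Icc 1 k, (q ^ 2 - (2 * (j : ℝ) - 1) ^ 2)) = v at h3 ⊢
    push_cast at h4 ⊢
    field_simp
    ring
  · have h1 := he (k + 1)
    have h2 := ho (k + 1)
    simp only [powScale, show (2 * k + 1 + 1) % 2 = 0 by omega,
      show (2 * k + 1 + 2) % 2 ≠ 0 by omega, show (2 * k + 1 + 1) / 2 = k + 1 by omega,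
      show (2 * k + 1 + 2) / 2 = k + 1 by omega, Nat.add_sub_cancel, if_true, if_false]
    rw [Finset.prod_Icc_succ_top (a := 1) (b := k) (by omega) (fun j : ℕ => q ^ 2 - (2 * (j : ℝ)) ^ 2)]
      at h1 ⊢
    obtain ⟨h3, h4⟩ := mul_ne_zero_iff.1 h1
    generalize (∏ j ∈ Finset.Icc 1 k, (q ^ 2 - (2 * (j : ℝ)) ^ 2)) = u at h3 ⊢
    generalize (∏ j ∈ Finset.Icc 1 (k + 1), (q ^ 2 - (2 * (j : ℝ) - 1) ^ 2)) = v at h2 ⊢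
    push_cast at h4 ⊢
    rw [show (2 * (k : ℝ) + 1 + 1) = 2 * ((k : ℝ) + 1) by ring]
    generalize q ^ 2 - (2 * ((k : ℝ) + 1)) ^ 2 = r at h4 ⊢
    field_simp

lemma logScale_mul (n : ℕ) :
    logScale (n + 1) * logScale (n + 2) * ((0 : ℝ) ^ 2 - (n + 1) ^ 2) = 1 := by
  have he : ∀ k : ℕ, ∏ j ∈ Finset.Icc 1 k, (2 * (j : ℝ)) ≠ 0 := fun k =>
    Finset.prod_ne_zero_iff.2 fun j hj => by
      have : (1 : ℝ) ≤ j := by exact_mod_cast (Finset.mem_Icc.1 hj).1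
      linarith
  have ho : ∀ k : ℕ, ∏ j ∈ Finset.Icc 1 k, (2 * (j : ℝ) - 1) ≠ 0 := fun k =>
    Finset.prod_ne_zero_iff.2 fun j hj => by
      have : (1 : ℝ) ≤ j := by exact_mod_cast (Finset.mem_Icc.1 hj).1
      linarith
  obtain ⟨k, rfl | rfl⟩ := Nat.even_or_odd' n
  · have h1 := he k
    have h2 := ho (k + 1)
    simp only [logScale, show (2 * k + 1) % 2 ≠ 0 by omega, show (2 * k + 2) % 2 = 0 by omega,
      show (2 * k + 1) / 2 = k by omega, show (2 * k + 2) / 2 = k + 1 by omega,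
      Nat.add_sub_cancel, if_true, if_false]
    rw [Finset.prod_Icc_succ_top (by omega)] at h2 ⊢
    obtain ⟨h3, h4⟩ := mul_ne_zero_iff.1 h2
    generalize (∏ j ∈ Finset.Icc 1 k, 2 * (j : ℝ)) = u at h1 ⊢
    generalize (∏ j ∈ Finset.Icc 1 k, (2 * (j : ℝ) - 1)) = v at h3 ⊢
    push_cast at h4 ⊢
    field_simp
    ring
  · have h1 := he (k + 1)
    have h2 := ho (k + 1)
    simp only [logScale, show (2 * k + 1 + 1) % 2 = 0 by omega,
      show (2 * k + 1 + 2) % 2 ≠ 0 by omega, show (2 * k + 1 + 1) / 2 = k + 1 by omega,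
      show (2 * k + 1 + 2) / 2 = k + 1 by omega, Nat.add_sub_cancel, if_true, if_false]
    rw [Finset.prod_Icc_succ_top (a := 1) (b := k) (by omega) (fun j : ℕ => 2 * (j : ℝ))]
      at h1 ⊢
    obtain ⟨h3, h4⟩ := mul_ne_zero_iff.1 h1
    generalize (∏ j ∈ Finset.Icc 1 k, 2 * (j : ℝ)) = u at h3 ⊢
    generalize (∏ j ∈ Finset.Icc 1 (k + 1), (2 * (j : ℝ) - 1)) = v at h2 ⊢
    push_cast at h4 ⊢
    field_simp
    ring

/-- The coefficient `A'ₙ` at a point of the spectrum, with `φ` as its parameter. -/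
def powScalar (q φ : ℝ) (n : ℕ) : ℝ :=
  if n = 0 then 1 else if n = 1 then (-1 - q * φ) / (2 * q * φ)
  else powScale q n * (2 * n - 1) / φ

/-- The coefficient `Ã'ₙ` at a point `x` of the spectrum; the value `φ` is a separate parameter. -/
def logScalar (x φ : ℝ) (n : ℕ) : ℝ :=
  if n = 0 then x - 1 else logScale n * (2 * n - 1) / φ

lemma tendsto_simple_rpow {q x : ℝ} (hq : 0 < q) (hq1 : q < 1) (hx : 0 < x) (hx1 : x ≠ 1) :
    Tendsto (fun n => simpleNum (powScalar q ((1 - x) / (1 + x))) n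
      / simpleDen (powScalar q ((1 - x) / (1 + x))) n) atTop (𝓝 (x ^ q)) := by
  refine (tendsto_eulerSeq_rpow hq hq1 hx hx1).congr fun n => ?_
  have hφ : (1 - x) / (1 + x) ≠ 0 := div_ne_zero (sub_ne_zero.2 hx1.symm) (by positivity)
  generalize (1 - x) / (1 + x) = φ at *
  have ha : ∀ n : ℕ, powScalar q φ (n + 2) = powScale q (n + 2) * (2 * n + 3) / φ := fun n => by
    simp only [powScalar, show n + 2 ≠ 0 by omega, show n + 2 ≠ 1 by omega, if_false]
    push_cast
    ring
  have hscale := contSeq_eq_prod_mul_eulerSeq hφ ha (powScale_mul hq hq1)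
  have h1 : powScalar q φ 1 * powScalar q φ 0 + 1 = powScale q 1 / φ * (1 - q * φ) := by
    simp [powScalar, powScale]; field_simp; ring
  have h2 : powScalar q φ 1 = powScale q 1 / φ * (1 + q * φ) := by
    simp [powScalar, powScale]; field_simp; ring
  rw [simpleNum, simpleDen, h1, hscale, h2, hscale,
    mul_div_mul_left _ _ (prod_div_ne_zero_of_mul_eq_one hφ (powScale_mul hq hq1) n)]
  simp [powScalar]

lemma tendsto_simple_log {x : ℝ} (hx : 0 < x) (hx1 : x ≠ 1) :
    Tendsto (fun n => simpleNum (logScalar x ((1 - x) / (1 + x))) n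
      / simpleDen (logScalar x ((1 - x) / (1 + x))) n) atTop (𝓝 (x - 1 - Real.log x)) := by
  refine (tendsto_eulerSeq_log hx).congr fun n => ?_
  have hφ : (1 - x) / (1 + x) ≠ 0 := div_ne_zero (sub_ne_zero.2 hx1.symm) (by positivity)
  generalize (1 - x) / (1 + x) = φ at *
  have ha : ∀ n : ℕ, logScalar x φ (n + 2) = logScale (n + 2) * (2 * n + 3) / φ := fun n => by
    simp only [logScalar, show n + 2 ≠ 0 by omega, if_false]
    push_cast
    ring
  have hscale := contSeq_eq_prod_mul_eulerSeq hφ ha logScale_mul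
  have h1 : logScalar x φ 1 * logScalar x φ 0 + 1 = logScale 1 / φ * (x - 1 + 2 * φ) := by
    simp [logScalar, logScale]; field_simp; ring
  have h2 : logScalar x φ 1 = logScale 1 / φ * 1 := by
    simp [logScalar, logScale]; norm_num
  rw [simpleNum, simpleDen, h1, hscale, h2, hscale,
    mul_div_mul_left _ _ (prod_div_ne_zero_of_mul_eq_one hφ logScale_mul n)]
  simp [logScalar]

/-! ### A continued fraction whose convergents are products of convergents -/

section Product

variable {R : Type*} [CommRing R] (a d : ℕ → R)

lemma simple_det (n : ℕ) :
    simpleNum a (n + 1) * simpleDen a n - simpleNum a n * simpleDen a (n + 1) = (-1) ^ n := by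
  induction n with
  | zero => simp [simpleNum, simpleDen, contSeq]; ring
  | succ n ih =>
    rw [pow_succ, ← ih]
    simp only [simpleNum, simpleDen, contSeq]
    ring

/-- The product of the numerators of two simple continued fractions. -/
def prodNum (n : ℕ) : R := simpleNum a n * simpleNum d n

/-- The product of the denominators of two simple continued fractions. -/
def prodDen (n : ℕ) : R := simpleDen a n * simpleDen d n

/-- Up to sign, the numerator of the difference of the products of convergents at `n + 1` and `n`; see
`prodNum_mul_sub`. -/
def prodGap (n : ℕ) : R :=
  simpleDen a (n + 1) * simpleNum a n + simpleDen d n * simpleNum d (n + 1)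

/-- The common factor, at index `n + 1`, by which the numerators and denominators of the continued
fraction of `D_q` exceed `prodNum` and `prodDen`. -/
def prodFactor : ℕ → R
  | 0 => 1
  | 1 => prodGap a d 0
  | n + 2 => prodGap a d (n + 1) * prodDen a d (n + 2) * prodFactor (n + 1)

/-- The gap is unchanged when the indices `n` and `n + 1` are exchanged in both summands, since both
fractions have the same determinant `(-1) ^ n`. -/
lemma prodGap_eq (n : ℕ) :
    simpleDen a n * simpleNum a (n + 1) + simpleDen d (n + 1) * simpleNum d n = prodGap a d n := by
  rw [prodGap]
  linear_combination simple_det a n - simple_det d n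

lemma prodNum_mul_sub (n : ℕ) :
    prodNum a d (n + 1) * prodDen a d n - prodDen a d (n + 1) * prodNum a d n
      = (-1) ^ n * prodGap a d n := by
  simp only [prodNum, prodDen, prodGap]
  linear_combination simpleNum d (n + 1) * simpleDen d n * simple_det a n
    + simpleNum a n * simpleDen a (n + 1) * simple_det d n

lemma prodDen_recurrence (n : ℕ) :
    (prodDen a d (n + 3) * prodGap a d (n + 1) - prodDen a d (n + 1) * prodGap a d (n + 2))
        * (prodDen a d (n + 2) * prodFactor a d (n + 1))
      + prodDen a d (n + 2) * prodGap a d (n + 2) * prodFactor a d (n + 1) * prodDen a d (n + 1)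
      = prodDen a d (n + 3) * prodFactor a d (n + 2) := by
  rw [prodFactor]
  ring

lemma prodNum_recurrence (n : ℕ) :
    (prodDen a d (n + 3) * prodGap a d (n + 1) - prodDen a d (n + 1) * prodGap a d (n + 2))
        * (prodNum a d (n + 2) * prodFactor a d (n + 1))
      + prodDen a d (n + 2) * prodGap a d (n + 2) * prodFactor a d (n + 1) * prodNum a d (n + 1)
      = prodNum a d (n + 3) * prodFactor a d (n + 2) := by
  rw [prodFactor]
  linear_combination (-prodFactor a d (n + 1) * prodGap a d (n + 2)) * prodNum_mul_sub a d (n + 1)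
    + (-prodFactor a d (n + 1) * prodGap a d (n + 1)) * prodNum_mul_sub a d (n + 2)

end Product

/-! ### Diagonalization -/

/-- Diagonalizing a positive definite matrix `M` with eigenvalues `x` identifies its functional calculus
with an injective continuous algebra homomorphism from the diagonal matrices. -/
lemma exists_algHom_cfc {M : Matrix (Fin m) (Fin m) ℝ} (hM : M.PosDef) :
    ∃ (Φ : (Fin m → ℝ) →ₐ[ℝ] Matrix (Fin m) (Fin m) ℝ) (x : Fin m → ℝ),
      (∀ i, 0 < x i) ∧ Continuous Φ ∧ Function.Injective Φ ∧ M = Φ x ∧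
      ∀ f : ℝ → ℝ, cfc f M = Φ (fun i => f (x i)) := by
  have hH := hM.isHermitian
  let U := Unitary.conjStarAlgAut ℝ (Matrix (Fin m) (Fin m) ℝ) hH.eigenvectorUnitary
  let Φ : (Fin m → ℝ) →ₐ[ℝ] Matrix (Fin m) (Fin m) ℝ :=
    (U : Matrix (Fin m) (Fin m) ℝ →ₐ[ℝ] Matrix (Fin m) (Fin m) ℝ).comp
      (diagonalAlgHom ℝ)
  have hcfc : ∀ f : ℝ → ℝ, cfc f M = Φ (fun i => f (hH.eigenvalues i)) := fun f => by
    rw [hH.cfc_eq]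
    rfl
  refine ⟨Φ, hH.eigenvalues, hM.eigenvalues_pos, ?_, ?_, ?_, hcfc⟩
  · exact Φ.toLinearMap.continuous_of_finiteDimensional
  · exact (EquivLike.injective U).comp diagonal_injective
  · exact (cfc_id ℝ M hH).symm.trans (hcfc id)

section Diag

variable {Φ : (Fin m → ℝ) →ₐ[ℝ] Matrix (Fin m) (Fin m) ℝ}

lemma algHom_inv {f : Fin m → ℝ} (hf : ∀ i, f i ≠ 0) : (Φ f)⁻¹ = Φ f⁻¹ := by
  apply Matrix.inv_eq_left_inv
  rw [← map_mul, ← map_one Φ]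
  congr 1
  ext i
  simp [hf i]

lemma ne_zero_of_isUnit_algHom (hΦ : Function.Injective Φ) {f : Fin m → ℝ} (hf : IsUnit (Φ f))
    (i : Fin m) : f i ≠ 0 := by
  intro hi
  have h : Φ f * Φ (Pi.single i 1) = 0 := by
    rw [← map_mul, ← map_zero Φ]
    congr 1
    ext j
    by_cases hj : j = i
    · subst hj; simp [hi]
    · simp [hj]
  have h2 := hΦ (((hf.mul_right_eq_zero).1 h).trans (map_zero Φ).symm)
  simpa using congrFun h2 i

lemma phi_algHom {x : Fin m → ℝ} (hx : ∀ i, 0 < x i) :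
    phi (Φ x) = Φ (fun i => (1 - x i) / (1 + x i)) := by
  have h : (1 + Φ x) = Φ (1 + x) := by simp
  rw [phi, h, algHom_inv (f := 1 + x) fun i => (add_pos one_pos (hx i)).ne', ← map_one Φ, ← map_sub, ← map_mul]
  congr 1
  ext i
  simp [div_eq_inv_mul]

/-- The coefficients `A'ₙ` of `Φ x`, as vectors of their values on the spectrum. -/
def powVec (q : ℝ) (x : Fin m → ℝ) (n : ℕ) : Fin m → ℝ :=
  fun i => powScalar q ((1 - x i) / (1 + x i)) n

/-- The coefficients `Ã'ₙ` of `Φ x`, as vectors of their values on the spectrum. -/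
def logVec (x : Fin m → ℝ) (n : ℕ) : Fin m → ℝ :=
  fun i => logScalar (x i) ((1 - x i) / (1 + x i)) n

lemma powCoef_algHom {q : ℝ} (hq : q ≠ 0) {x : Fin m → ℝ} (hx : ∀ i, 0 < x i)
    (hx1 : ∀ i, x i ≠ 1) (n : ℕ) : powCoef q (Φ x) n = Φ (powVec q x n) := by
  have hφ : ∀ i, (1 - x i) / (1 + x i) ≠ 0 := fun i =>
    div_ne_zero (sub_ne_zero.2 (hx1 i).symm) (add_pos one_pos (hx i)).ne'
  rw [powCoef, phi_algHom hx]
  unfold powVec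
  generalize hψ : (fun i => (1 - x i) / (1 + x i)) = ψ
  have hψ' : ∀ i, (1 - x i) / (1 + x i) = ψ i := fun i => congrFun hψ i
  simp only [hψ'] at hφ ⊢
  rw [← map_smul, ← map_smul, algHom_inv hφ,
    algHom_inv (f := (2 * q) • ψ) fun i => mul_ne_zero (mul_ne_zero two_ne_zero hq) (hφ i)]
  split_ifs with h0 h1 h2
  · subst h0
    rw [← map_one Φ]; rfl
  · subst h1
    rw [← map_one Φ, ← map_neg, ← map_sub, ← map_mul]
    congr 1
    ext i
    simp [powScalar, div_eq_inv_mul]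
  · rw [← map_smul]
    congr 1
    ext i
    have : (4 * ((n / 2 : ℕ) : ℝ) - 1) = 2 * n - 1 := by
      have : (n : ℝ) = 2 * (n / 2 : ℕ) := by exact_mod_cast (by omega : n = 2 * (n / 2))
      rw [this]; ring
    simp only [powScalar, powScale, h0, h1, h2, if_true, if_false, this, Pi.smul_apply,
      Pi.inv_apply, smul_eq_mul, ← div_eq_mul_inv]
  · rw [← map_smul]
    congr 1
    ext i
    have : (4 * ((n / 2 : ℕ) : ℝ) + 1) = 2 * n - 1 := by
      have : (n : ℝ) = 2 * (n / 2 : ℕ) + 1 := by exact_mod_cast (by omega : n = 2 * (n / 2) + 1)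
      rw [this]; ring
    simp only [powScalar, powScale, h0, h1, h2, if_false, this, Pi.smul_apply,
      Pi.inv_apply, smul_eq_mul, ← div_eq_mul_inv]

lemma logCoef_algHom {x : Fin m → ℝ} (hx : ∀ i, 0 < x i)
    (hx1 : ∀ i, x i ≠ 1) (n : ℕ) : logCoef (Φ x) n = Φ (logVec x n) := by
  have hφ : ∀ i, (1 - x i) / (1 + x i) ≠ 0 := fun i =>
    div_ne_zero (sub_ne_zero.2 (hx1 i).symm) (add_pos one_pos (hx i)).ne'
  rw [logCoef, phi_algHom hx, algHom_inv hφ]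
  split_ifs with h0 h2
  · subst h0
    rw [← map_one Φ, ← map_sub]; rfl
  · rw [← map_smul]
    congr 1
    ext i
    have : (4 * ((n / 2 : ℕ) : ℝ) - 1) = 2 * n - 1 := by
      have : (n : ℝ) = 2 * (n / 2 : ℕ) := by exact_mod_cast (by omega : n = 2 * (n / 2))
      rw [this]; ring
    simp only [logVec, logScalar, logScale, h0, h2, if_true, if_false, this, Pi.smul_apply,
      Pi.inv_apply, smul_eq_mul, ← div_eq_mul_inv]
  · rw [← map_smul]
    congr 1
    ext i
    have : (4 * ((n / 2 : ℕ) : ℝ) + 1) = 2 * n - 1 := by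
      have : (n : ℝ) = 2 * (n / 2 : ℕ) + 1 := by exact_mod_cast (by omega : n = 2 * (n / 2) + 1)
      rw [this]; ring
    simp only [logVec, logScalar, logScale, h0, h2, if_false, this, Pi.smul_apply,
      Pi.inv_apply, smul_eq_mul, ← div_eq_mul_inv]

lemma cfNum_algHom {a : ℕ → Matrix (Fin m) (Fin m) ℝ} {v : ℕ → Fin m → ℝ}
    (h : ∀ n, a n = Φ (v n)) (n : ℕ) : cfNum a (fun _ => 1) n = Φ (simpleNum v n) := by
  induction n using Nat.twoStepInduction with
  | zero => simp [cfNum, simpleNum, contSeq, h]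
  | one => simp [cfNum, simpleNum, contSeq, h]
  | more n h₀ h₁ =>
    rw [cfNum, h₀, h₁, h]
    simp [simpleNum, contSeq]

lemma cfDen_algHom {a : ℕ → Matrix (Fin m) (Fin m) ℝ} {v : ℕ → Fin m → ℝ}
    (h : ∀ n, a n = Φ (v n)) (n : ℕ) : cfDen a (fun _ => 1) n = Φ (simpleDen v n) := by
  induction n using Nat.twoStepInduction with
  | zero => simp [cfDen, simpleDen, contSeq]
  | one => simp [cfDen, simpleDen, contSeq, h]
  | more n h₀ h₁ =>
    rw [cfDen, h₀, h₁, h]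
    simp [simpleDen, contSeq]

variable {q : ℝ} {x : Fin m → ℝ}

lemma seqE_algHom (hq : q ≠ 0) (hx : ∀ i, 0 < x i) (hx1 : ∀ i, x i ≠ 1) (n : ℕ) :
    seqE q (Φ x) (n + 2)
      = Φ (prodDen (powVec q x) (logVec x) (n + 2) * prodGap (powVec q x) (logVec x) n) := by
  have hp := powCoef_algHom (Φ := Φ) hq hx hx1
  have hl := logCoef_algHom (Φ := Φ) hx hx1
  simp only [seqE, powDen, powNum, logDen, logNum, cfNum_algHom hp, cfDen_algHom hp,
    cfNum_algHom hl, cfDen_algHom hl, ← map_mul, ← map_add]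
  rw [← prodGap_eq]
  rfl

lemma seqF_algHom (hq : q ≠ 0) (hx : ∀ i, 0 < x i) (hx1 : ∀ i, x i ≠ 1) (n : ℕ) :
    seqF q (Φ x) (n + 2)
      = Φ (prodDen (powVec q x) (logVec x) n * prodGap (powVec q x) (logVec x) (n + 1)) := by
  have hp := powCoef_algHom (Φ := Φ) hq hx hx1
  have hl := logCoef_algHom (Φ := Φ) hx hx1
  simp only [seqF, powDen, powNum, logDen, logNum, cfNum_algHom hp, cfDen_algHom hp,
    cfNum_algHom hl, cfDen_algHom hl, ← map_mul, ← map_add]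
  rfl

end Diag

/-! ### The continued fraction of the divergence -/

/-- Numerators and denominators of the continued fraction of `D_q(A|B)`. The first three steps, whose
elements have their own shape, carry the factors `A^{±1/2}`; afterwards the recurrence runs in the image
of `Φ`. Well-definedness enters only through the inverse of `A'₁ Ã'₁` in the third partial numerator. -/
lemma cf_div_eq {q : ℝ} (hq : q ≠ 0) {A B : Matrix (Fin m) (Fin m) ℝ}
    {Φ : (Fin m → ℝ) →ₐ[ℝ] Matrix (Fin m) (Fin m) ℝ} (hΦ : Function.Injective Φ)
    {x : Fin m → ℝ} (hx : ∀ i, 0 < x i) (hx1 : ∀ i, x i ≠ 1)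
    (hX : relMat A B = Φ x) (hTS : mpow A (-(1 / 2)) * mpow A (1 / 2) = 1)
    (hBA : B - A = mpow A (1 / 2) * Φ (x - 1) * mpow A (1 / 2))
    (hunit : IsUnit (mpow A (-(1 / 2))))
    (hwd : CFWellDefined (divA q A B) (divB q A B)) (n : ℕ) :
    cfDen (divA q A B) (divB q A B) (n + 1) = Φ (prodDen (powVec q x) (logVec x) (n + 1)
        * prodFactor (powVec q x) (logVec x) n) * mpow A (-(1 / 2)) ∧
    cfNum (divA q A B) (divB q A B) (n + 1) = Φ (prodNum (powVec q x) (logVec x) (n + 1)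
        * prodFactor (powVec q x) (logVec x) n) * mpow A (1 / 2) := by
  set S := mpow A (1 / 2)
  set T := mpow A (-(1 / 2))
  have hp : ∀ n, powCoef q (relMat A B) n = Φ (powVec q x n) :=
    fun n => by rw [hX]; exact powCoef_algHom hq hx hx1 n
  have hl : ∀ n, logCoef (relMat A B) n = Φ (logVec x n) :=
    fun n => by rw [hX]; exact logCoef_algHom hx hx1 n
  have hE := seqE_algHom (Φ := Φ) hq hx hx1
  have hF := seqF_algHom (Φ := Φ) hq hx hx1
  rw [← hX] at hE hF
  have hp0 : powVec q x 0 = 1 := rfl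
  have hl0 : logVec x 0 = x - 1 := rfl
  set a := powVec q x
  set d := logVec x
  have hD1 : cfDen (divA q A B) (divB q A B) 1 = Φ (a 1 * d 1) * T := by
    simp only [cfDen, divA, hp, hl, map_mul]; rfl
  have hN1 : cfNum (divA q A B) (divB q A B) 1 = Φ (a 1 * d 1 * d 0 + (a 1 + 1 + d 0 * d 1)) * S := by
    have : cfNum (divA q A B) (divB q A B) 1
        = Φ (a 1) * Φ (d 1) * T * (B - A) + (Φ (a 1) + 1 + Φ (d 0) * Φ (d 1)) * S := by
      simp only [cfNum, divA, divB, hp, hl]; rfl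
    rw [this, hBA, ← hl0]
    simp only [map_add, map_mul, map_one]
    have e : T * (S * Φ (d 0) * S) = Φ (d 0) * S := by
      rw [← mul_assoc, ← mul_assoc, hTS, one_mul]
    rw [mul_assoc (Φ (a 1) * Φ (d 1)) T, e]
    noncomm_ring
  have hw1 : ∀ i, (a 1 * d 1) i ≠ 0 := by
    have h1 := hwd 1
    rw [hD1] at h1
    exact ne_zero_of_isUnit_algHom hΦ (hunit.mul_right_iff.1 h1)
  set a2 := (a 1 * a 2 + a 2 + 1) * d 2 + a 2 * d 0 * (d 1 * d 2 + 1) with ha2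
  set b2 := (a 1 * a 2 + 1) * (a 1 + 1) + d 1 * d 2 + d 0 * d 1 * (d 1 * d 2 + 1) with hb2
  have hA2 : divA q A B 2 = Φ a2 := by
    simp only [divA, hp, hl, ha2, map_add, map_mul, map_one]
  have hB2 : divB q A B 2 = Φ b2 * T := by
    simp only [divB, hp, hl, hb2, map_add, map_mul, map_one]; rfl
  have hAn : ∀ n, divA q A B (n + 3) = Φ (prodDen a d (n + 3) * prodGap a d (n + 1)
      - prodDen a d (n + 1) * prodGap a d (n + 2)) := fun n => by
    rw [map_sub, ← hE, ← hF]; rfl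
  have hB3 : divB q A B 3 = Φ (prodDen a d 2 * prodGap a d 0 * prodGap a d 2) := by
    have : divB q A B 3 = (Φ (a 1 * d 1))⁻¹ * seqE q (relMat A B) 2 * seqF q (relMat A B) 3 := by
      simp only [divB, hp, hl, map_mul]
    rw [this, algHom_inv hw1, hE 0, hF 1, ← map_mul, ← map_mul]
    congr 1
    have e : prodDen a d 1 = a 1 * d 1 := rfl
    ext i
    have := hw1 i
    rw [e]
    simp only [Pi.mul_apply, Pi.inv_apply, zero_add, one_add_one_eq_two] at this ⊢
    generalize a 1 i * d 1 i = r at this ⊢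
    field_simp
  have hBn : ∀ n, divB q A B (n + 4) = Φ (prodDen a d (n + 3) * prodGap a d (n + 1)
      * (prodDen a d (n + 2) * prodGap a d (n + 3))) := fun n => by
    rw [map_mul, ← hE, ← hF]; rfl
  have hstep : ∀ {s t u v w : Fin m → ℝ} {M : Matrix (Fin m) (Fin m) ℝ}, s * t + u * v = w →
      Φ s * (Φ t * M) + Φ u * (Φ v * M) = Φ w * M := by
    rintro s t u v w M rfl
    simp only [map_add, map_mul, add_mul, mul_assoc]
  induction n using Nat.twoStepInduction with
  | zero =>
    refine ⟨?_, ?_⟩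
    · rw [hD1]; simp [prodDen, prodFactor, simpleDen, contSeq]
    · rw [hN1]
      congr 2
      simp [prodNum, prodFactor, simpleNum, contSeq, hp0]
      ring
  | one =>
    refine ⟨?_, ?_⟩
    · rw [cfDen, hD1, hA2, hB2]
      rw [cfDen, mul_one, ← mul_assoc, ← map_mul, ← add_mul, ← map_add]
      congr 2
      simp only [prodDen, prodFactor, prodGap, simpleNum, simpleDen, contSeq, hp0, a2, b2]
      ring
    · rw [cfNum, hN1, hA2, hB2, cfNum]
      have e : Φ b2 * T * divA q A B 0 = Φ b2 * (Φ (d 0) * S) := by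
        rw [divA, hBA, ← hl0, mul_assoc, ← mul_assoc T, ← mul_assoc T, hTS, one_mul]
      rw [e]
      refine hstep ?_
      simp only [prodNum, prodFactor, prodGap, simpleNum, simpleDen, contSeq, hp0, a2, b2]
      ring
  | more n h₀ h₁ =>
    -- The third and the later partial numerators differ by the normalization that `prodFactor` records.
    have key : divB q A B (n + 3) * Φ (prodFactor a d n)
        = Φ (prodDen a d (n + 2) * prodGap a d (n + 2) * prodFactor a d (n + 1)) := by
      cases n with
      | zero =>
        rw [hB3, ← map_mul]; congr 1; simp only [prodFactor]; ring
      | succ n =>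
        rw [hBn, ← map_mul]; congr 1; simp only [prodFactor]; ring
    have keyD := prodDen_recurrence a d n
    have keyN := prodNum_recurrence a d n
    refine ⟨?_, ?_⟩
    · rw [show n + 2 + 1 = n + 1 + 2 from rfl, cfDen, h₁.1, h₀.1, mul_comm (prodDen a d (n + 1)),
        map_mul Φ (prodFactor a d n), mul_assoc (Φ (prodFactor a d n)),
        ← mul_assoc (divB q A B (n + 1 + 2)), key, hAn]
      exact hstep keyD
    · rw [show n + 2 + 1 = n + 1 + 2 from rfl, cfNum, h₁.2, h₀.2, mul_comm (prodNum a d (n + 1)),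
        map_mul Φ (prodFactor a d n), mul_assoc (Φ (prodFactor a d n)),
        ← mul_assoc (divB q A B (n + 1 + 2)), key, hAn]
      exact hstep keyN

end OpDiv
end

theorem theorem4p1 (m : ℕ) (q : ℝ) (hq0 : 0 < q) (hq1 : q < 1)
    (A B : Matrix (Fin m) (Fin m) ℝ) (hA : A.PosDef) (hB : B.PosDef)
    (hAB : IsUnit (A - B))
    (hwd : OpDiv.CFWellDefined (OpDiv.divA q A B) (OpDiv.divB q A B)) :
    OpDiv.CFConvergesTo (OpDiv.divA q A B) (OpDiv.divB q A B) (OpDiv.opDivergence q A B) := by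
  open OpDiv Matrix Filter Topology in
  obtain ⟨Ψ, y, hy, -, -, hAy, hAcfc⟩ := exists_algHom_cfc hA
  have hpow : ∀ s, mpow A s = Ψ (fun i => y i ^ s) := fun s => hAcfc _
  have hmul : ∀ s t, mpow A s * mpow A t = Ψ (fun i => y i ^ (s + t)) := fun s t => by
    rw [hpow, hpow, ← map_mul]
    congr 1
    ext i
    simp [Real.rpow_add (hy i)]
  have hTS : mpow A (-(1 / 2)) * mpow A (1 / 2) = 1 := by
    rw [hmul, ← map_one Ψ]; congr 1; ext i; simp
  have hST : mpow A (1 / 2) * mpow A (-(1 / 2)) = 1 := by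
    rw [hmul, ← map_one Ψ]; congr 1; ext i; simp
  have hSS : mpow A (1 / 2) * mpow A (1 / 2) = A := by
    rw [hmul, hAy]; congr 1; ext i; norm_num
  have hT : IsUnit (mpow A (-(1 / 2))) := ⟨⟨_, _, hTS, hST⟩, rfl⟩
  have hTH : (mpow A (-(1 / 2)))ᴴ = mpow A (-(1 / 2)) := cfc_predicate (fun x : ℝ => x ^ (-(1 / 2 : ℝ))) A
  have hX : (relMat A B).PosDef := by
    have := hB.conjTranspose_mul_mul_same (B := mpow A (-(1 / 2)))
      (Matrix.mulVec_injective_of_isUnit hT)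
    rwa [hTH] at this
  obtain ⟨Φ, x, hx, hcont, hinj, hXx, hXcfc⟩ := exists_algHom_cfc hX
  have hSXS : mpow A (1 / 2) * relMat A B * mpow A (1 / 2) = B := by
    rw [relMat, mul_assoc, mul_assoc (_ * B), hTS, mul_one, ← mul_assoc, hST, one_mul]
  have hBA : B - A = mpow A (1 / 2) * Φ (x - 1) * mpow A (1 / 2) := by
    rw [map_sub, map_one, ← hXx, mul_sub, sub_mul, mul_one, hSXS, hSS]
  have hx1 : ∀ i, x i ≠ 1 := by
    have h1 : IsUnit (Φ (x - 1)) := by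
      have h2 : Φ (x - 1) = mpow A (-(1 / 2)) * (B - A) * mpow A (-(1 / 2)) := by
        rw [hBA, mul_assoc, mul_assoc (_ * _), hST, mul_one, ← mul_assoc, hTS, one_mul]
      rw [h2, ← neg_sub A B]
      exact (hT.mul hAB.neg).mul hT
    exact fun i => sub_ne_zero.1 (ne_zero_of_isUnit_algHom hinj h1 i)
  have hcf := cf_div_eq hq0.ne' hinj hx hx1 hXx hTS hBA hT hwd
  have hconv : ∀ n, cfConvergent (divA q A B) (divB q A B) (n + 1)
      = mpow A (1 / 2) * Φ (fun i =>
        (simpleNum (powScalar q ((1 - x i) / (1 + x i))) (n + 1)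
          / simpleDen (powScalar q ((1 - x i) / (1 + x i))) (n + 1))
        * (simpleNum (logScalar (x i) ((1 - x i) / (1 + x i))) (n + 1)
          / simpleDen (logScalar (x i) ((1 - x i) / (1 + x i))) (n + 1))) * mpow A (1 / 2) := by
    intro n
    -- Well-definedness cancels the common factor of numerator and denominator.
    have hu := hwd (n + 1)
    rw [(hcf n).1] at hu
    have hne := ne_zero_of_isUnit_algHom hinj (hT.mul_right_iff.1 hu)
    rw [cfConvergent, (hcf n).1, (hcf n).2, Matrix.mul_inv_rev, algHom_inv hne,
      Matrix.inv_eq_left_inv hST, mul_assoc, ← mul_assoc (Φ _), ← map_mul, ← mul_assoc]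
    congr 3
    ext i
    have h := hne i
    simp only [Pi.mul_apply, Pi.inv_apply] at h ⊢
    have h2 := right_ne_zero_of_mul h
    have e1 : prodNum (powVec q x) (logVec x) (n + 1) i
        = simpleNum (powScalar q ((1 - x i) / (1 + x i))) (n + 1)
          * simpleNum (logScalar (x i) ((1 - x i) / (1 + x i))) (n + 1) := by
      simp only [prodNum, Pi.mul_apply, simpleNum, contSeq_pi_apply]; rfl
    have e2 : prodDen (powVec q x) (logVec x) (n + 1) i
        = simpleDen (powScalar q ((1 - x i) / (1 + x i))) (n + 1)
          * simpleDen (logScalar (x i) ((1 - x i) / (1 + x i))) (n + 1) := by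
      simp only [prodDen, Pi.mul_apply, simpleDen, contSeq_pi_apply]; rfl
    rw [← div_eq_inv_mul, mul_div_mul_right _ _ h2, e1, e2, mul_div_mul_comm]
  have hval : opDivergence q A B
      = mpow A (1 / 2) * Φ (fun i => x i ^ q * (x i - 1 - Real.log (x i))) * mpow A (1 / 2) := by
    have e : ∀ s, mpow (relMat A B) s = Φ (fun i => x i ^ s) := fun s => hXcfc _
    have el : mlog (relMat A B) = Φ (fun i => Real.log (x i)) := hXcfc _
    rw [opDivergence, opPath, opPath, opEntropy, e, e, el, ← sub_mul, ← sub_mul, ← mul_sub,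
      ← mul_sub, ← map_mul, ← map_sub, ← map_sub]
    congr 3
    ext i
    simp only [Pi.sub_apply, Pi.mul_apply]
    rw [add_comm, Real.rpow_add_one (hx i).ne']
    ring
  rw [CFConvergesTo, ← tendsto_add_atTop_iff_nat 1, hval]
  simp only [hconv]
  refine (((hcont.tendsto _).comp ?_).const_mul _).mul_const _
  refine tendsto_pi_nhds.2 fun i => ?_
  exact (((tendsto_simple_rpow hq0 hq1 (hx i) (hx1 i)).mul
    (tendsto_simple_log (hx i) (hx1 i))).comp (tendsto_add_atTop_nat 1))
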